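/- Let $1\le N\le 4$, let $\Omega\subset\mathbb{R}^N$ be a bounded domain (nonempty, open, connected; no regularity of $\partial\Omega$ is needed), let $m\in\mathbb{N}$, and let $H=H_0^1(\Omega,\mathbb{R}^m)=H_0^1(\Omega)^m$, where $H_0^1(\Omega)$ is the closure of $C_c^\infty(\Omega)$ in $H^1(\Omega)$. Let $\varepsilon_1,\dots,\varepsilon_m>0$. Let $\mathbf g=(g_{ij})\in\mathbb{R}^{m\times m}$ be a symmetric matrix such that either $g_{ij}>0$ for all $i,j$, or $\mathbf g$ is positive definite. Let $a_1,\dots,a_m\in L^\infty(\Omega)$ satisfy $a_i(x)>-\lambda_1$ for a.e. $x\in\Omega$ and all $i$, where $\lambda_1$ is the first Dirichlet eigenvalue of $-\Delta$ in $\Omega$. For $\mathbf u=(u_1,\dots,u_m)\in H$ put $$E(\mathbf u)=\frac12\int_\Omega\sum_{i=1}^m\bigl(\varepsilon_i|\nabla u_i|^2+a_iu_i^2\bigr)\,dx-\frac14\int_\Omega\sum_{i,j=1}^m g_{ij}u_i^2u_j^2\,dx .$$ Then $E\in C^2(H,\mathbb{R})$. Let $\mathcal N=\{\mathbf u\in H\setminus\{0\}:\langle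 E'(\mathbf u),\mathbf u\rangle=0\}$ be the Nehari manifold, with the topology induced by $H$. A $1$-saddle of $E$ in $H$ is a point $\mathbf u\in H$ with $E'(\mathbf u)=0$ and Morse index $1$, i.e. the maximal dimension of a subspace of $H$ on which the quadratic form $\mathbf v\mapsto\langle E''(\mathbf u)\mathbf v,\mathbf v\rangle$ is negative definite is $1$; it is nondegenerate if $E''(\mathbf u):H\to H^*$ is invertible with bounded inverse. The following hold. (a) Every local minimizer of $E$ on $\mathcal N$ is a $1$-saddle of $E$ in $H$. (b) Every nondegenerate $1$-saddle $\mathbf u\neq0$ of $E$ in $H$ belongs to $\mathcal N$ and is a strict local minimizer of $E$ on $\mathcal N$. -/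

import Mathlib

open MeasureTheory Filter
open scoped Topology ContDiff Gradient

noncomputable section

namespace Nehari

/-- The `N`-dimensional Euclidean space. -/
abbrev Eucl (N : ℕ) : Type := EuclideanSpace ℝ (Fin N)

/-- The Hilbert space `L²(Ω) × L²(Ω, ℝ^N)`, with `‖(u, p)‖² = ∫_Ω u² + ∫_Ω |p|²`. -/
abbrev L2Pair {N : ℕ} (Ω : Set (Eucl N)) : Type :=
  WithLp 2 (Lp ℝ 2 (volume.restrict Ω) × Lp (Eucl N) 2 (volume.restrict Ω))

/-- `φ` is a test function on `Ω`: smooth, with compact support contained in `Ω`. -/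
structure IsTestFunction {N : ℕ} (Ω : Set (Eucl N)) (φ : Eucl N → ℝ) : Prop where
  contDiff : ContDiff ℝ ∞ φ
  hasCompactSupport : HasCompactSupport φ
  tsupport_subset : tsupport φ ⊆ Ω

/-- The pairs `(φ, ∇φ)`, `φ ∈ C_c^∞(Ω)`, as a linear subspace of `L²(Ω) × L²(Ω, ℝ^N)`. -/
def testGraph {N : ℕ} (Ω : Set (Eucl N)) : Submodule ℝ (L2Pair Ω) where
  carrier := {w | ∃ φ : Eucl N → ℝ, IsTestFunction Ω φ ∧
    w.fst =ᵐ[volume.restrict Ω] φ ∧ w.snd =ᵐ[volume.restrict Ω] ∇ φ}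
  zero_mem' := by
    refine ⟨fun _ => 0, ⟨contDiff_const, HasCompactSupport.zero, by simp [tsupport]⟩, ?_, ?_⟩
    · exact Lp.coeFn_zero ℝ 2 (volume.restrict Ω)
    · filter_upwards [Lp.coeFn_zero (Eucl N) 2 (volume.restrict Ω)] with x hx
      simpa [gradient] using hx
  add_mem' := by
    rintro v w ⟨φ, hφ, hv1, hv2⟩ ⟨ψ, hψ, hw1, hw2⟩
    refine ⟨φ + ψ, ⟨hφ.contDiff.add hψ.contDiff,
      hφ.hasCompactSupport.add hψ.hasCompactSupport, ?_⟩, ?_, ?_⟩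
    · exact (tsupport_add φ ψ).trans (Set.union_subset hφ.tsupport_subset hψ.tsupport_subset)
    · filter_upwards [Lp.coeFn_add v.fst w.fst, hv1, hw1] with x h h1 h2
      refine h.trans ?_
      simp [h1, h2]
    · filter_upwards [Lp.coeFn_add v.snd w.snd, hv2, hw2] with x h h1 h2
      have d1 : DifferentiableAt ℝ φ x := (hφ.contDiff.differentiable (by simp)) x
      have d2 : DifferentiableAt ℝ ψ x := (hψ.contDiff.differentiable (by simp)) x
      refine h.trans ?_
      simp [h1, h2, gradient, fderiv_add d1 d2]
  smul_mem' := by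
    rintro c w ⟨φ, hφ, hw1, hw2⟩
    refine ⟨c • φ, ⟨hφ.contDiff.const_smul c, ?_, ?_⟩, ?_, ?_⟩
    · exact hφ.hasCompactSupport.smul_left (f := fun _ => c)
    · exact (tsupport_smul_subset_right (fun _ => c) φ).trans hφ.tsupport_subset
    · filter_upwards [Lp.coeFn_smul c w.fst, hw1] with x h h1
      simp [h, h1]
    · filter_upwards [Lp.coeFn_smul c w.snd, hw2] with x h h1
      have d1 : DifferentiableAt ℝ φ x := (hφ.contDiff.differentiable (by simp)) x
      simp [h, h1, gradient, fderiv_const_smul d1]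

/-- The Sobolev space `H_0^1(Ω)`: the closure of `C_c^∞(Ω)` in the norm
`(∫_Ω u² + ∫_Ω |∇u|²)^{1/2}`. A function `u ∈ H_0^1(Ω)` is represented by the pair `(u, ∇u)` of
itself and its weak gradient (which `u` determines). For bounded `Ω` this norm is equivalent to
every norm `(∫_Ω ε |∇u|²)^{1/2}`, `ε > 0`. -/
abbrev H01 {N : ℕ} (Ω : Set (Eucl N)) : Submodule ℝ (L2Pair Ω) :=
  (testGraph Ω).topologicalClosure

/-- The function in `L²(Ω)` underlying an element of `H_0^1(Ω)`. -/
def fn {N : ℕ} {Ω : Set (Eucl N)} (u : H01 Ω) : Lp ℝ 2 (volume.restrict Ω) :=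
  (u : L2Pair Ω).fst

/-- The weak gradient of an element of `H_0^1(Ω)`. -/
def grad {N : ℕ} {Ω : Set (Eucl N)} (u : H01 Ω) : Lp (Eucl N) 2 (volume.restrict Ω) :=
  (u : L2Pair Ω).snd

/-- The Hilbert space `H_0^1(Ω, ℝ^m) = H_0^1(Ω)^m`. -/
abbrev HSpace {N : ℕ} (Ω : Set (Eucl N)) (m : ℕ) : Type :=
  PiLp 2 (fun _ : Fin m => H01 Ω)

/-- `lam` is a Dirichlet eigenvalue of `-Δ` in `Ω`: there is a nonzero `u ∈ H_0^1(Ω)` with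
`-Δu = lam u` weakly. -/
def IsDirichletEigenvalue {N : ℕ} (Ω : Set (Eucl N)) (lam : ℝ) : Prop :=
  ∃ u : H01 Ω, u ≠ 0 ∧ ∀ v : H01 Ω,
    (∫ x in Ω, inner ℝ (grad u x) (grad v x)) = lam * (∫ x in Ω, fn u x * fn v x)

/-- The first Dirichlet eigenvalue `λ₁` of `-Δ` in `Ω`. -/
def firstDirichletEigenvalue {N : ℕ} (Ω : Set (Eucl N)) : ℝ :=
  sInf {lam | IsDirichletEigenvalue Ω lam}

/-- The energy `E(u) = ½ ∫_Ω ∑ᵢ (εᵢ |∇uᵢ|² + aᵢ uᵢ²) - ¼ ∫_Ω ∑ᵢⱼ gᵢⱼ uᵢ² uⱼ²`. -/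
def energy {N : ℕ} (Ω : Set (Eucl N)) {m : ℕ} (ε : Fin m → ℝ) (a : Fin m → Eucl N → ℝ)
    (g : Matrix (Fin m) (Fin m) ℝ) (u : HSpace Ω m) : ℝ :=
  (1 / 2) * (∫ x in Ω, ∑ i, (ε i * ‖grad (u i) x‖ ^ 2 + a i x * (fn (u i) x) ^ 2))
    - (1 / 4) * (∫ x in Ω, ∑ i, ∑ j, g i j * (fn (u i) x) ^ 2 * (fn (u j) x) ^ 2)

section Abstract

variable {H : Type*} [NormedAddCommGroup H] [NormedSpace ℝ H]

/-- `u` is a critical point of `E`: `E` is Fréchet differentiable at `u` and `E'(u) = 0`. -/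
def IsCriticalPoint (E : H → ℝ) (u : H) : Prop :=
  HasFDerivAt E (0 : H →L[ℝ] ℝ) u

/-- The second Fréchet derivative `E''(u) : H → H*`. -/
def hessian (E : H → ℝ) (u : H) : H →L[ℝ] (H →L[ℝ] ℝ) :=
  fderiv ℝ (fderiv ℝ E) u

/-- The subspace `V` is negative definite for the bilinear form `B`. -/
def IsNegDefOn (B : H →L[ℝ] (H →L[ℝ] ℝ)) (V : Submodule ℝ H) : Prop :=
  ∀ v ∈ V, v ≠ 0 → B v v < 0

/-- The Morse index of `E` at `u`: the maximal dimension (possibly `∞`) of a subspace on which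
`E''(u)` is negative definite. -/
def morseIndex (E : H → ℝ) (u : H) : ℕ∞ :=
  ⨆ (V : Submodule ℝ H) (_ : IsNegDefOn (hessian E u) V), Cardinal.toENat (Module.rank ℝ V)

/-- A `1`-saddle of `E`: a critical point with Morse index `1`. -/
def IsOneSaddle (E : H → ℝ) (u : H) : Prop :=
  IsCriticalPoint E u ∧ morseIndex E u = 1

/-- `u` is nondegenerate for `E`: `E''(u) : H → H*` is invertible, with bounded inverse. -/
def IsNondegenerate (E : H → ℝ) (u : H) : Prop :=
  (hessian E u).IsInvertible

/-- The Nehari manifold `{u ∈ H \ {0} : ⟨E'(u), u⟩ = 0}`. -/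
def nehari (E : H → ℝ) : Set H :=
  {u | u ≠ 0 ∧ fderiv ℝ E u u = 0}

/-- `u` is a local minimizer of `E` on the set `S`. -/
def IsLocalMinimizerOn (E : H → ℝ) (S : Set H) (u : H) : Prop :=
  u ∈ S ∧ IsLocalMinOn E S u

/-- `u` is a strict local minimizer of `E` on the set `S`. -/
def IsStrictLocalMinimizerOn (E : H → ℝ) (S : Set H) (u : H) : Prop :=
  u ∈ S ∧ ∀ᶠ v in 𝓝[S] u, v ≠ u → E u < E v

end Abstract

end Nehari

end

namespace Nehari

/-! ### The Nehari constraint, Taylor expansion and constrained minimizers of a `C²` functional. -/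

section Abstract

variable {H : Type*} [NormedAddCommGroup H] [NormedSpace ℝ H] {E : H → ℝ} {u : H}

/-! Along rays `E(tu) = t² Q(u)/2 - t⁴ G(u)/4`, so `E'(u)u = Q - G` and `E''(u)[u,u] = Q - 3G`. On
the Nehari manifold `Q = G`, and `G > 0` there (`quartPart_pos`), hence `E''(u)[u,u] = -2G < 0`.
Beyond `E ∈ C²`, which rests on `H_0^1 ⊂ L⁴` for `N ≤ 4`, nothing else about `E` is needed.

With `J(v) = E'(v)v`, this sign gives `J'(u)u ≠ 0`, so the Lagrange multiplier of a constrained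
minimizer vanishes and `u` is critical. At a critical point `J'(u) = E''(u)u`: the tangent space of
the manifold is the hyperplane conjugate to `u`, a complement of `ℝu`. Hence index one amounts to
`E'' ≥ 0` on that hyperplane. Minimality implies this inequality (`hessian_nonneg_of_isLocalMinOn`).
Conversely, nondegeneracy upgrades it to coercivity (`exists_norm_sq_le_of_isInvertible`), and
Taylor expansion yields strict minimality. -/

lemma hessian_symm (hE : ContDiff ℝ 2 E) (u v w : H) : hessian E u v w = hessian E u w v :=
  (hE.contDiffAt.isSymmSndFDerivAt (by simp)) v w

lemma contDiff_fderiv_one (hE : ContDiff ℝ 2 E) : ContDiff ℝ 1 (fderiv ℝ E) :=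
  hE.fderiv_right (by norm_num)

lemma hasFDerivAt_fderiv (hE : ContDiff ℝ 2 E) (u : H) :
    HasFDerivAt (fderiv ℝ E) (hessian E u) u :=
  ((contDiff_fderiv_one hE).differentiable (by simp) u).hasFDerivAt

/-- The constraint `v ↦ ⟨E'(v), v⟩` whose zero set away from the origin is the Nehari manifold. -/
noncomputable def nehariConstraint (E : H → ℝ) (v : H) : ℝ := fderiv ℝ E v v

lemma contDiff_nehariConstraint (hE : ContDiff ℝ 2 E) : ContDiff ℝ 1 (nehariConstraint E) :=
  (contDiff_fderiv_one hE).clm_apply contDiff_id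

lemma hasFDerivAt_nehariConstraint (hE : ContDiff ℝ 2 E) (u : H) :
    HasFDerivAt (nehariConstraint E) (hessian E u u + fderiv ℝ E u) u := by
  refine ((hasFDerivAt_fderiv hE u).clm_apply (hasFDerivAt_id u)).congr_fderiv ?_
  ext v
  simp [hessian_symm hE u v u, add_comm]

/-- Second order Taylor expansion at a critical point. -/
lemma taylor_two_of_isCriticalPoint (hE : ContDiff ℝ 2 E) (hu : IsCriticalPoint E u) {c : ℝ}
    (hc : 0 < c) :
    ∀ᶠ h in 𝓝 (0 : H), |E (u + h) - E u - (1 / 2) * hessian E u h h| ≤ c * ‖h‖ ^ 2 := by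
  have h1 : ∀ᶠ h in 𝓝 (0 : H), ‖fderiv ℝ E (u + h) - hessian E u h‖ ≤ c * ‖h‖ := by
    have := (hasFDerivAt_iff_isLittleO_nhds_zero.1 (hasFDerivAt_fderiv hE u)).def hc
    simpa [hu.fderiv] using this
  obtain ⟨r, hr, hb⟩ := Metric.eventually_nhds_iff_ball.1 h1
  filter_upwards [Metric.ball_mem_nhds (0 : H) hr] with h hh
  have hd : ∀ x ∈ Metric.closedBall (0 : H) ‖h‖, HasFDerivWithinAt
      (fun x => E (u + x) - E u - (1 / 2) * hessian E u x x)
      (fderiv ℝ E (u + x) - hessian E u x) (Metric.closedBall (0 : H) ‖h‖) x := by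
    intro x _
    have e1 : HasFDerivAt (fun x => E (u + x)) (fderiv ℝ E (u + x)) x :=
      ((hE.differentiable (by simp) (u + x)).hasFDerivAt.comp x ((hasFDerivAt_id x).const_add u))
    have e2 : HasFDerivAt (fun x => hessian E u x x) (2 • hessian E u x) x := by
      refine ((hessian E u).hasFDerivAt.clm_apply (hasFDerivAt_id x)).congr_fderiv ?_
      ext v
      simp [hessian_symm hE u v x, two_mul]
    refine (((e1.sub_const (E u)).sub (e2.const_mul (1 / 2))).congr_fderiv ?_).hasFDerivWithinAt
    ext v
    simp
  have hbd : ∀ x ∈ Metric.closedBall (0 : H) ‖h‖,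
      ‖fderiv ℝ E (u + x) - hessian E u x‖ ≤ c * ‖h‖ := by
    intro x hx
    rw [mem_closedBall_zero_iff] at hx
    rw [mem_ball_zero_iff] at hh
    exact (hb x (mem_ball_zero_iff.2 (hx.trans_lt hh))).trans (by gcongr)
  have := (convex_closedBall (0 : H) ‖h‖).norm_image_sub_le_of_norm_hasFDerivWithin_le hd hbd
    (Metric.mem_closedBall_self (norm_nonneg h)) (mem_closedBall_zero_iff.2 le_rfl)
  simpa [sq, mul_assoc] using this

/-- If `E''(u)` is negative on `u` and on a vector conjugate to it, then the Nehari manifold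
meets the plane spanned by the two in points of energy below `E(u)`, arbitrarily close to `u`. -/
lemma hessian_nonneg_of_isLocalMinOn (hE : ContDiff ℝ 2 E) (hu : IsCriticalPoint E u)
    (hu0 : u ≠ 0) (hneg : hessian E u u u < 0) (hmin : IsLocalMinOn E (nehari E) u)
    {v : H} (hv : hessian E u u v = 0) : 0 ≤ hessian E u v v := by
  by_contra! hvv
  obtain ⟨p, hp⟩ : ∃ p : ℝ × ℝ → H, p = fun q => q.1 • u + q.2 • v := ⟨_, rfl⟩
  have hpc : Continuous p := by rw [hp]; fun_prop
  have hp0 : p 0 = 0 := by simp [hp]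
  have hpt : Tendsto p (𝓝 0) (𝓝 0) := by simpa [hp0] using hpc.tendsto 0
  have hut : Tendsto (fun q => u + p q) (𝓝 0) (𝓝 u) := by
    simpa using tendsto_const_nhds.add hpt
  -- the energy decreases along the plane
  obtain ⟨c, hc, hcu, hcv⟩ : ∃ c > 0, c * (4 * ‖u‖ ^ 2) < - hessian E u u u ∧
      c * (4 * ‖v‖ ^ 2) < - hessian E u v v := by
    have t : ∀ A B : ℝ, 0 < B → ∀ᶠ c in 𝓝[>] (0 : ℝ), c * A < B := by
      intro A B hB
      have : Tendsto (fun c : ℝ => c * A) (𝓝[>] 0) (𝓝 (0 * A)) :=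
        ((continuous_id.mul continuous_const).tendsto 0).mono_left nhdsWithin_le_nhds
      rw [zero_mul] at this
      exact this.eventually (gt_mem_nhds hB)
    have hpos : ∀ᶠ c in 𝓝[>] (0 : ℝ), 0 < c := self_mem_nhdsWithin
    obtain ⟨c, h1, h2, h3⟩ := (hpos.and
      ((t (4 * ‖u‖ ^ 2) _ (neg_pos.2 hneg)).and (t (4 * ‖v‖ ^ 2) _ (neg_pos.2 hvv)))).exists
    exact ⟨c, h1, h2, h3⟩
  have hdec : ∀ᶠ q in 𝓝 (0 : ℝ × ℝ), q.2 ≠ 0 → E (u + p q) < E u := by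
    filter_upwards [hpt.eventually (taylor_two_of_isCriticalPoint hE hu hc)] with q hq hq2
    have hB : hessian E u (p q) (p q) =
        q.1 ^ 2 * hessian E u u u + q.2 ^ 2 * hessian E u v v := by
      have := hessian_symm hE u v u
      simp only [hp, map_add, map_smul, add_apply, smul_apply,
        smul_eq_mul, this, hv]
      ring
    -- The factor 2 comes from `(x + y)² ≤ 2x² + 2y²`; with the `1/2` in the Taylor expansion it
    -- accounts for the 4 in the choice of `c`.
    have hn : ‖p q‖ ^ 2 ≤ 2 * (q.1 ^ 2 * ‖u‖ ^ 2 + q.2 ^ 2 * ‖v‖ ^ 2) := by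
      have h1 : ‖p q‖ ≤ |q.1| * ‖u‖ + |q.2| * ‖v‖ := by
        rw [hp]
        refine (norm_add_le _ _).trans ?_
        simp [norm_smul]
      have h2 : ‖p q‖ ^ 2 ≤ (|q.1| * ‖u‖ + |q.2| * ‖v‖) ^ 2 := by gcongr
      have h3 := sq_nonneg (|q.1| * ‖u‖ - |q.2| * ‖v‖)
      rw [← sq_abs q.1, ← sq_abs q.2]
      nlinarith
    have h1 := (abs_le.1 hq).2
    have h2 : 0 < q.2 ^ 2 := by positivity
    have h3 := mul_le_mul_of_nonneg_left hn hc.le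
    have h4 := mul_lt_mul_of_pos_left hcv h2
    have h5 := mul_le_mul_of_nonneg_left hcu.le (sq_nonneg q.1)
    rw [hB] at h1
    nlinarith
  have hmin' : ∀ᶠ q in 𝓝 (0 : ℝ × ℝ), u + p q ∈ nehari E → E u ≤ E (u + p q) :=
    hut.eventually (eventually_nhdsWithin_iff.1 hmin)
  have hne : ∀ᶠ q in 𝓝 (0 : ℝ × ℝ), u + p q ≠ 0 := hut.eventually_ne hu0
  obtain ⟨r, hr, hball⟩ := Metric.eventually_nhds_iff_ball.1 (hdec.and (hmin'.and hne))
  -- the constraint changes sign along the direction `u`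
  have hJc : Continuous fun q => nehariConstraint E (u + p q) :=
    (contDiff_nehariConstraint hE).continuous.comp (continuous_const.add hpc)
  have hd : HasDerivAt (fun s : ℝ => nehariConstraint E (u + p (s, 0))) (hessian E u u u) 0 := by
    have e : HasDerivAt (fun s : ℝ => u + p (s, 0)) u 0 := by
      simpa [hp] using ((hasDerivAt_id (0 : ℝ)).smul_const u).const_add u
    have hJ := hasFDerivAt_nehariConstraint hE u
    have := HasFDerivAt.comp_hasDerivAt (0 : ℝ) (f := fun s : ℝ => u + p (s, 0))
      (by simpa [hp] using hJ) e
    simpa [hu.fderiv] using! this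
  have hJ0 : nehariConstraint E (u + p (0, 0)) = 0 := by
    simp [hp, nehariConstraint, hu.fderiv]
  have hslope := (hasDerivAt_iff_tendsto_slope.1 hd).eventually (gt_mem_nhds hneg)
  rw [eventually_nhdsWithin_iff] at hslope
  obtain ⟨d, hd0, hslope⟩ := Metric.eventually_nhds_iff_ball.1 hslope
  obtain ⟨δ, hδ0, hδr, hδd⟩ : ∃ δ > 0, δ < r ∧ δ < d :=
    ⟨min r d / 2, by positivity, by have := min_le_left r d; have := lt_min hr hd0; linarith,
      by have := min_le_right r d; have := lt_min hr hd0; linarith⟩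
  have hplus : nehariConstraint E (u + p (δ, 0)) < 0 := by
    have := hslope δ (by simp [abs_of_pos hδ0, hδd]) (by simpa using hδ0.ne')
    rw [slope_def_field, hJ0, sub_zero, sub_zero] at this
    by_contra! hcon
    exact absurd this (not_lt.2 (div_nonneg hcon hδ0.le))
  have hminus : 0 < nehariConstraint E (u + p (-δ, 0)) := by
    have := hslope (-δ) (by simp [abs_of_pos hδ0, hδd]) (by simpa using hδ0.ne')
    rw [slope_def_field, hJ0, sub_zero, sub_zero] at this
    by_contra! hcon
    exact absurd this (not_lt.2 (div_nonneg_of_nonpos hcon (by linarith)))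
  have hc1 : ∀ s : ℝ, Tendsto (fun t : ℝ => nehariConstraint E (u + p (s, t))) (𝓝[≠] 0)
      (𝓝 (nehariConstraint E (u + p (s, 0)))) := fun s =>
    ((hJc.comp (Continuous.prodMk_right s)).tendsto 0).mono_left nhdsWithin_le_nhds
  have htb : ∀ᶠ t in 𝓝[≠] (0 : ℝ), t ∈ Metric.ball 0 r :=
    nhdsWithin_le_nhds (Metric.ball_mem_nhds (0 : ℝ) hr)
  have htn : ∀ᶠ t in 𝓝[≠] (0 : ℝ), t ≠ 0 := self_mem_nhdsWithin
  -- The signs at `s = ±δ` survive a small shift `t ≠ 0` along `v`. The intermediate value theorem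
  -- then gives a Nehari point off the line `ℝu`, where the energy is strictly below `E u`; no
  -- implicit function theorem is needed.
  obtain ⟨t, ht1, ht2, htr, ht0⟩ := (((hc1 δ).eventually (gt_mem_nhds hplus)).and
    (((hc1 (-δ)).eventually (lt_mem_nhds hminus)).and
    (htb.and htn))).exists
  obtain ⟨s, hs, hs0⟩ : (0 : ℝ) ∈ (fun s => nehariConstraint E (u + p (s, t))) '' Set.Icc (-δ) δ :=
    intermediate_value_Icc' (by linarith)
      (hJc.comp (Continuous.prodMk_left t)).continuousOn ⟨ht1.le, ht2.le⟩
  obtain ⟨k1, k2, k3⟩ := hball (s, t) (by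
    rw [mem_ball_zero_iff, Prod.norm_def]
    exact max_lt ((abs_le.2 hs).trans_lt hδr) (mem_ball_zero_iff.1 htr))
  exact absurd (k2 ⟨k3, hs0⟩) (not_le.2 (k1 ht0))

lemma isCriticalPoint_of_isLocalMinimizerOn_nehari [CompleteSpace H] (hE : ContDiff ℝ 2 E)
    (hneg : hessian E u u u < 0) (hmin : IsLocalMinimizerOn E (nehari E) u) :
    IsCriticalPoint E u := by
  obtain ⟨⟨hu0, huN⟩, hmin⟩ := hmin
  have hJ := (contDiff_nehariConstraint hE).contDiffAt.hasStrictFDerivAt'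
    (hasFDerivAt_nehariConstraint hE u) (by simp)
  have hEd := (hE.contDiffAt (x := u)).hasStrictFDerivAt (by simp)
  have hext : IsLocalExtrOn E {x | nehariConstraint E x = nehariConstraint E u} u := by
    left
    have h2 := eventually_nhdsWithin_iff.1 hmin
    refine eventually_nhdsWithin_iff.2 ?_
    filter_upwards [h2, isOpen_ne.mem_nhds hu0] with x hx hx0 hxJ
    exact hx ⟨hx0, hxJ.trans huN⟩
  obtain ⟨a, b, hab, h⟩ := hext.exists_multipliers_of_hasStrictFDerivAt_1d hJ hEd
  -- Evaluated at `u`, the relation `a J' + b E' = 0` reads `a E''(u)[u,u] = 0`, so `a = 0`.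
  have hau := congrArg (fun L : H →L[ℝ] ℝ => L u) h
  simp only [add_apply, smul_apply, smul_eq_mul, huN,
    mul_zero, add_zero, zero_apply, mul_eq_zero, hneg.ne, or_false] at hau
  have hb : b ≠ 0 := fun hb => hab (by simp [hau, hb])
  rw [hau, zero_smul, zero_add, smul_eq_zero_iff_right hb] at h
  have := hEd.hasFDerivAt
  rwa [h] at this

/-! ### Morse index one and the hyperplane conjugate to `u`. -/

lemma one_le_morseIndex (hneg : hessian E u u u < 0) : 1 ≤ morseIndex E u := by
  have hu0 : u ≠ 0 := by rintro rfl; simp at hneg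
  have hV : IsNegDefOn (hessian E u) (ℝ ∙ u) := by
    intro v hv hv0
    obtain ⟨c, rfl⟩ := Submodule.mem_span_singleton.1 hv
    have hc : c ≠ 0 := fun hc => hv0 (by simp [hc])
    have : 0 < c * c := mul_self_pos.2 hc
    simp only [map_smul, smul_apply, smul_eq_mul, ← mul_assoc]
    exact mul_neg_of_pos_of_neg this hneg
  refine le_iSup₂_of_le (ℝ ∙ u) hV ?_
  rw [(rank_submodule_eq_one_iff _).2 ⟨u, Submodule.mem_span_singleton_self u, hu0, le_rfl⟩]
  simp

/-- On a negative definite subspace the functional `E''(u)u` has trivial kernel, so the subspace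
embeds in `ℝ`. -/
lemma morseIndex_le_one (hnn : ∀ v, hessian E u u v = 0 → 0 ≤ hessian E u v v) :
    morseIndex E u ≤ 1 := by
  refine iSup₂_le fun V hV => ?_
  have hinj : Function.Injective ((hessian E u u : H →ₗ[ℝ] ℝ) ∘ₗ V.subtype) := by
    rw [← LinearMap.ker_eq_bot, LinearMap.ker_eq_bot']
    intro v hv
    by_contra hv0
    exact absurd (hV v v.2 (by simpa using hv0)) (not_lt.2 (hnn v hv))
  have := LinearMap.lift_rank_le_of_injective _ hinj
  rw [Module.rank_self, Cardinal.lift_one, Cardinal.lift_le_one_iff] at this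
  simpa using Cardinal.toENat.monotone' this

lemma isOneSaddle_of_isLocalMinimizerOn_nehari [CompleteSpace H] (hE : ContDiff ℝ 2 E)
    (hneg : ∀ u ∈ nehari E, hessian E u u u < 0) (hmin : IsLocalMinimizerOn E (nehari E) u) :
    IsOneSaddle E u := by
  have hu := hneg u hmin.1
  have hcrit := isCriticalPoint_of_isLocalMinimizerOn_nehari hE hu hmin
  exact ⟨hcrit, le_antisymm (morseIndex_le_one fun v hv =>
    hessian_nonneg_of_isLocalMinOn hE hcrit hmin.1.1 hu hmin.2 hv) (one_le_morseIndex hu)⟩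

/-- Otherwise `u` and `w`, being conjugate, would span a negative definite plane. -/
lemma hessian_nonneg_of_morseIndex_le_one (hE : ContDiff ℝ 2 E) (hneg : hessian E u u u < 0)
    (hind : morseIndex E u ≤ 1) {w : H} (hw : hessian E u u w = 0) : 0 ≤ hessian E u w w := by
  by_contra! hww
  have hw' : hessian E u w u = 0 := (hessian_symm hE u w u).trans hw
  have hli : LinearIndependent ℝ ![u, w] := by
    rw [LinearIndependent.pair_iff]
    intro s t hst
    have h1 := congrArg (hessian E u u) hst
    have h2 := congrArg (hessian E u w) hst
    simp [hw, hneg.ne] at h1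
    simp [hw', hww.ne] at h2
    exact ⟨h1, h2⟩
  have hV : IsNegDefOn (hessian E u) (Submodule.span ℝ {u, w}) := by
    intro v hv hv0
    obtain ⟨s, t, rfl⟩ := Submodule.mem_span_pair.1 hv
    have : hessian E u (s • u + t • w) (s • u + t • w) =
        s ^ 2 * hessian E u u u + t ^ 2 * hessian E u w w := by
      simp [hw, hw']
      ring
    rw [this]
    rcases eq_or_ne s 0 with rfl | hs
    · have ht : t ≠ 0 := fun ht => hv0 (by simp [ht])
      have : 0 < t ^ 2 := by positivity
      nlinarith
    · have : 0 < s ^ 2 := by positivity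
      have := sq_nonneg t
      nlinarith
  have hle : Cardinal.toENat (Module.rank ℝ (Submodule.span ℝ {u, w})) ≤ 1 :=
    (le_iSup₂_of_le (f := fun (V : Submodule ℝ H) (_ : IsNegDefOn (hessian E u) V) =>
      Cardinal.toENat (Module.rank ℝ V)) _ hV le_rfl).trans hind
  have hr : Module.rank ℝ (Submodule.span ℝ {u, w}) = 2 := by
    have := rank_span hli
    rw [Matrix.range_cons_cons_empty] at this
    rw [this, Cardinal.mk_insert (by simpa using hli.injective.ne (zero_ne_one (α := Fin 2))),
      Cardinal.mk_singleton, one_add_one_eq_two]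
  rw [hr] at hle
  simp at hle

/-- Coercivity of a nondegenerate form that is nonnegative on a conjugate hyperplane. -/
lemma exists_norm_sq_le_of_isInvertible {B : H →L[ℝ] H →L[ℝ] ℝ} (hsymm : ∀ v w, B v w = B w v)
    (hB : B.IsInvertible) (hneg : B u u < 0) (hnn : ∀ w, B u w = 0 → 0 ≤ B w w) :
    ∃ K C : ℝ, 0 < K ∧ 0 < C ∧ ∀ x, ‖x‖ ^ 2 ≤ K * (B u x) ^ 2 + C * B x x := by
  obtain ⟨T, rfl⟩ := hB
  set B : H →L[ℝ] H →L[ℝ] ℝ := (T : H →L[ℝ] H →L[ℝ] ℝ) with hBdef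
  obtain ⟨b, hb⟩ : ∃ b, b = - B u u := ⟨_, rfl⟩
  have hb0 : 0 < b := by linarith
  -- the form `P x y = B x y - B u x * B u y / B u u` is positive semidefinite
  let P : H →ₗ[ℝ] H →ₗ[ℝ] ℝ := LinearMap.mk₂ ℝ (fun x y => B x y + B u x * B u y / b)
    (by intros; simp; ring) (by intros; simp; ring) (by intros; simp; ring) (by intros; simp; ring)
  have hP : ∀ x y, P x y = B x y + B u x * B u y / b := fun _ _ => rfl
  -- `x + (B u x / b) • u` is the projection of `x` onto the conjugate hyperplane along `u`, and `P`
  -- is the pullback of `B` by it; hence `P ≥ 0`.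
  have hproj : ∀ x, B u (x + (B u x / b) • u) = 0 := by
    intro x
    have : B u u = -b := by linarith
    simp only [map_add, map_smul, smul_eq_mul, this]
    field_simp
    ring
  have hPB : ∀ x, B (x + (B u x / b) • u) (x + (B u x / b) • u) = P x x := by
    intro x
    have h1 : B u u = -b := by linarith
    have h2 := hsymm x u
    simp only [map_add, map_smul, smul_eq_mul, add_apply,
      smul_apply, h1, h2, hP]
    field_simp
    ring
  have hP0 : ∀ x, 0 ≤ P x x := fun x => hPB x ▸ hnn _ (hproj x)
  have hPs : P.IsSymm := ⟨fun x y => by simp [hP, hsymm x y]; ring⟩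
  obtain ⟨M, hM⟩ : ∃ M, M = ‖B‖ + ‖B u‖ ^ 2 / b := ⟨_, rfl⟩
  have hM0 : 0 ≤ M := by rw [hM]; positivity
  have hPM : ∀ x, P x x ≤ M * ‖x‖ ^ 2 := by
    intro x
    have h1 : B x x ≤ ‖B‖ * ‖x‖ * ‖x‖ := (le_abs_self _).trans (B.le_opNorm₂ x x)
    have h2 : B u x * B u x ≤ (‖B u‖ * ‖x‖) ^ 2 := by
      rw [← sq, ← sq_abs]
      gcongr
      exact (B u).le_opNorm x
    have h3 : B u x * B u x / b ≤ (‖B u‖ * ‖x‖) ^ 2 / b := by gcongr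
    rw [hP, hM]
    calc _ ≤ ‖B‖ * ‖x‖ * ‖x‖ + (‖B u‖ * ‖x‖) ^ 2 / b := add_le_add h1 h3
      _ = _ := by ring
  obtain ⟨S, hS⟩ : ∃ S, S = ‖(T.symm : (H →L[ℝ] ℝ) →L[ℝ] H)‖ := ⟨_, rfl⟩
  -- Cauchy–Schwarz for `P` gives `(B w x)² ≤ B w w * M * ‖x‖²`, so `B w w` controls `‖B w‖²`, and
  -- the bounded inverse turns this into control of `‖w‖²`.
  have hcoer : ∀ w, B u w = 0 → ‖w‖ ^ 2 ≤ S ^ 2 * M * B w w := by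
    intro w hw
    have hBw : 0 ≤ B w w := hnn w hw
    have h1 : ‖B w‖ ≤ √(B w w * M) := by
      refine ContinuousLinearMap.opNorm_le_bound _ (Real.sqrt_nonneg _) fun x => ?_
      have := LinearMap.BilinForm.apply_sq_le_of_symm P hP0 hPs w x
      simp only [hP w, hw, zero_mul, zero_div, add_zero] at this
      have h2 : (B w x) ^ 2 ≤ B w w * M * ‖x‖ ^ 2 := by
        refine this.trans ?_
        rw [mul_assoc]
        exact mul_le_mul_of_nonneg_left (hPM x) hBw
      refine (Real.abs_le_sqrt h2).trans_eq ?_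
      rw [Real.sqrt_mul (by positivity), Real.sqrt_sq (norm_nonneg x)]
    have h2 : ‖w‖ ≤ S * ‖B w‖ := by
      have := (T.symm : (H →L[ℝ] ℝ) →L[ℝ] H).le_opNorm (B w)
      rw [← hS] at this
      simpa [hBdef] using this
    have hS0 : 0 ≤ S := by rw [hS]; positivity
    calc ‖w‖ ^ 2 ≤ (S * √(B w w * M)) ^ 2 := by gcongr; exact h2.trans (by gcongr)
      _ = _ := by rw [mul_pow, Real.sq_sqrt (by positivity)]; ring
  -- The `+ 1` only serves to make `C` positive.
  obtain ⟨C, hC⟩ : ∃ C, C = S ^ 2 * M + 1 := ⟨_, rfl⟩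
  have hC0 : 0 < C := by rw [hC]; positivity
  -- From `‖x‖² ≤ 2‖w‖² + 2(B u x)²‖u‖²/b²`, `w` the projection of `x`, and `‖w‖² ≤ C (B x x + (B u
  -- x)²/b)`.
  refine ⟨2 * C / b + 2 * (‖u‖ ^ 2 / b ^ 2), 2 * C, by positivity, by positivity, fun x => ?_⟩
  set w := x + (B u x / b) • u with hw
  have hx : x = w - (B u x / b) • u := by simp [hw]
  have h1 : ‖x‖ ≤ ‖w‖ + |B u x| / b * ‖u‖ := by
    conv_lhs => rw [hx]
    refine (norm_sub_le _ _).trans_eq ?_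
    simp [norm_smul, abs_of_pos hb0]
  have h2 : ‖x‖ ^ 2 ≤ 2 * ‖w‖ ^ 2 + 2 * (|B u x| / b * ‖u‖) ^ 2 := by
    have : ‖x‖ ^ 2 ≤ (‖w‖ + |B u x| / b * ‖u‖) ^ 2 := by gcongr
    nlinarith [sq_nonneg (‖w‖ - |B u x| / b * ‖u‖)]
  have h3 : ‖w‖ ^ 2 ≤ C * P x x := by
    refine (hcoer w (hproj x)).trans ?_
    rw [hPB x]
    exact mul_le_mul_of_nonneg_right (by linarith) (hP0 x)
  have h4 : (|B u x| / b * ‖u‖) ^ 2 = (B u x) ^ 2 * (‖u‖ ^ 2 / b ^ 2) := by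
    rw [mul_pow, div_pow, sq_abs]; ring
  rw [h4] at h2
  calc ‖x‖ ^ 2 ≤ 2 * (C * P x x) + 2 * ((B u x) ^ 2 * (‖u‖ ^ 2 / b ^ 2)) := by linarith
    _ = _ := by rw [hP]; ring

/-- For `v = u + h` on the manifold, `J(v) = J(u) = 0` makes `E''(u)[u,h] = o(‖h‖)`, so coercivity
reduces to `E''(u)[h,h] ≥ ‖h‖²/(2C)`, which dominates the Taylor remainder. -/
lemma isStrictLocalMinimizerOn_nehari (hE : ContDiff ℝ 2 E)
    (hneg : ∀ u ∈ nehari E, hessian E u u u < 0) (hu0 : u ≠ 0) (hs : IsOneSaddle E u)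
    (hnd : IsNondegenerate E u) : IsStrictLocalMinimizerOn E (nehari E) u := by
  obtain ⟨hcrit, hind⟩ := hs
  have huN : u ∈ nehari E := ⟨hu0, by simp [hcrit.fderiv]⟩
  refine ⟨huN, ?_⟩
  have hn := hneg u huN
  obtain ⟨K, C, hK, hC, hKC⟩ := exists_norm_sq_le_of_isInvertible (hessian_symm hE u) hnd hn
    (fun w hw => hessian_nonneg_of_morseIndex_le_one hE hn hind.le hw)
  have hJ : HasFDerivAt (nehariConstraint E) (hessian E u u) u := by
    simpa [hcrit.fderiv] using hasFDerivAt_nehariConstraint hE u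
  -- Chosen so that `K η² = 1/2`: half of `‖h‖²` is absorbed. The remainder constant `1/(8C)` then
  -- costs half of the quadratic gain.
  have hη : 0 < √(1 / (2 * K)) := by positivity
  have h1 := (hasFDerivAt_iff_isLittleO_nhds_zero.1 hJ).def hη
  have h2 := taylor_two_of_isCriticalPoint hE hcrit (c := 1 / (8 * C)) (by positivity)
  have ht : Tendsto (fun v => v - u) (𝓝 u) (𝓝 0) := by
    simpa using (continuous_id.sub continuous_const).tendsto (x := u) (f := fun v => v - u)
  refine eventually_nhdsWithin_iff.2 ?_
  filter_upwards [ht.eventually h1, ht.eventually h2] with v hv1 hv2 hvN hvu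
  have hvJ : nehariConstraint E v = 0 := hvN.2
  have huJ : nehariConstraint E u = 0 := huN.2
  set h := v - u with hh
  have hh0 : 0 < ‖h‖ ^ 2 := by
    have : h ≠ 0 := sub_ne_zero.2 hvu
    positivity
  have huh : u + h = v := by simp [hh]
  rw [huh] at hv1 hv2
  rw [hvJ, huJ, sub_zero, zero_sub, norm_neg, Real.norm_eq_abs] at hv1
  have h3 : (hessian E u u h) ^ 2 ≤ 1 / (2 * K) * ‖h‖ ^ 2 := by
    rw [← sq_abs]
    calc _ ≤ (√(1 / (2 * K)) * ‖h‖) ^ 2 := by gcongr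
      _ = _ := by rw [mul_pow, Real.sq_sqrt (by positivity)]
  have h4 : K * (hessian E u u h) ^ 2 ≤ ‖h‖ ^ 2 / 2 := by
    calc _ ≤ K * (1 / (2 * K) * ‖h‖ ^ 2) := by gcongr
      _ = _ := by field_simp
  have h5 : ‖h‖ ^ 2 / (2 * C) ≤ hessian E u h h := by
    rw [div_le_iff₀ (by positivity)]
    linarith [hKC h]
  have h6 := (abs_le.1 hv2).1
  have h7 : 1 / (8 * C) * ‖h‖ ^ 2 = (‖h‖ ^ 2 / (2 * C)) / 4 := by field_simp; ring
  have h8 : 0 < ‖h‖ ^ 2 / (2 * C) := by positivity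
  linarith

end Abstract


/-! ### The embedding of `H_0^1(Ω)` into `L⁴` for `N ≤ 4`. -/

section Sobolev

open scoped ENNReal NNReal

variable {N : ℕ} {Ω : Set (Eucl N)}

instance fact_one_le_four : Fact ((1 : ℝ≥0∞) ≤ 4) := ⟨by norm_num⟩

lemma norm_gradient (φ : Eucl N → ℝ) (x : Eucl N) : ‖∇ φ x‖ = ‖fderiv ℝ φ x‖ := by
  simp [gradient]

lemma eLpNorm_fderiv_eq_restrict_gradient {φ : Eucl N → ℝ} (hφ : IsTestFunction Ω φ) (p : ℝ≥0∞) :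
    eLpNorm (fderiv ℝ φ) p volume = eLpNorm (∇ φ) p (volume.restrict Ω) := by
  have hs : Function.support (fderiv ℝ φ) ⊆ Ω :=
    (support_fderiv_subset ℝ).trans hφ.tsupport_subset
  rw [← eLpNorm_restrict_eq_of_support_subset (f := fderiv ℝ φ) hs]
  exact eLpNorm_congr_norm_ae (ae_of_all _ fun x => (norm_gradient φ x).symm)

lemma aestronglyMeasurable_gradient {φ : Eucl N → ℝ} (hφ : IsTestFunction Ω φ)
    (μ : Measure (Eucl N)) : AEStronglyMeasurable (∇ φ) μ := by
  have h : Continuous (fderiv ℝ φ) := hφ.contDiff.continuous_fderiv (by simp)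
  exact ((InnerProductSpace.toDual ℝ (Eucl N)).symm.continuous.comp h).aestronglyMeasurable

lemma exists_eLpNorm_gradient_le (hΩ : Bornology.IsBounded Ω) {p : ℝ≥0∞} (hp : p ≤ 2)
    (hp0 : 1 ≤ p) :
    ∃ C : ℝ≥0, ∀ φ : Eucl N → ℝ, IsTestFunction Ω φ →
      eLpNorm (∇ φ) p (volume.restrict Ω) ≤ C * eLpNorm (∇ φ) 2 (volume.restrict Ω) := by
  have hvol : volume Ω ^ (1 / p.toReal - 1 / (2 : ℝ≥0∞).toReal) ≠ ⊤ := by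
    have hpt : p ≠ ⊤ := ne_top_of_le_ne_top (by simp) hp
    refine ENNReal.rpow_ne_top_of_nonneg ?_ hΩ.measure_lt_top.ne
    rw [sub_nonneg]
    refine one_div_le_one_div_of_le ?_ ?_
    · exact ENNReal.toReal_pos (by positivity) hpt
    · exact ENNReal.toReal_mono (by simp) hp
  refine ⟨(volume Ω ^ (1 / p.toReal - 1 / (2 : ℝ≥0∞).toReal)).toNNReal, fun φ hφ => ?_⟩
  rw [ENNReal.coe_toNNReal hvol, mul_comm]
  simpa using eLpNorm_le_eLpNorm_mul_rpow_measure_univ hp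
    (aestronglyMeasurable_gradient hφ (volume.restrict Ω))

/-- Gagliardo–Nirenberg–Sobolev at exponent `p < N`, followed by Hölder on the bounded set `Ω` to
pass from `p` to 2. -/
lemma exists_eLpNorm_four_le_of_lt (hΩ : Bornology.IsBounded Ω) {p : ℝ≥0} (hp1 : 1 ≤ p)
    (hp2 : p ≤ 2) (hpN : p < N) (hp : (p : ℝ)⁻¹ - (N : ℝ)⁻¹ ≤ 4⁻¹) :
    ∃ C : ℝ≥0, ∀ φ : Eucl N → ℝ, IsTestFunction Ω φ →
      eLpNorm φ 4 (volume.restrict Ω) ≤ C * eLpNorm (∇ φ) 2 (volume.restrict Ω) := by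
  obtain ⟨C, hC⟩ := exists_eLpNorm_gradient_le (p := p) hΩ (by exact_mod_cast hp2)
    (by exact_mod_cast hp1)
  refine ⟨eLpNormLESNormFDerivOfLeConst ℝ (volume : Measure (Eucl N)) Ω p 4 * C, fun φ hφ => ?_⟩
  have := eLpNorm_le_eLpNorm_fderiv_of_le (volume : Measure (Eucl N)) (s := Ω) (p := p) (q := 4)
    (hφ.contDiff.of_le (by simp)) ((subset_tsupport φ).trans hφ.tsupport_subset) hp1
    (by simpa using hpN) (by simpa using hp) hΩ
  rw [eLpNorm_fderiv_eq_restrict_gradient hφ] at this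
  refine (eLpNorm_mono_measure φ Measure.restrict_le_self).trans (this.trans ?_)
  rw [ENNReal.coe_mul, mul_assoc]
  gcongr
  exact hC φ hφ

/-- The fundamental theorem of calculus, after identifying `ℝ` isometrically with `Eucl 1`.
Dimension one needs this because no `p` satisfies `1 ≤ p < N`. -/
lemma enorm_le_eLpNorm_fderiv_one {φ : Eucl 1 → ℝ} (hφ : ContDiff ℝ 1 φ)
    (hc : HasCompactSupport φ) (x : Eucl 1) : ‖φ x‖ₑ ≤ eLpNorm (fderiv ℝ φ) 1 volume := by
  let L : ℝ ≃ₗᵢ[ℝ] Eucl 1 := (OrthonormalBasis.singleton (Fin 1) ℝ).repr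
  have hL : ContDiff ℝ 1 L := L.contDiff
  have hψ : ContDiff ℝ 1 (φ ∘ L) := hφ.comp hL
  have hψc : HasCompactSupport (φ ∘ L) := hc.comp_homeomorph L.toHomeomorph
  have hd : ∀ s, ‖deriv (φ ∘ L) s‖ₑ ≤ ‖fderiv ℝ φ (L s)‖ₑ := by
    intro s
    have h1 : HasDerivAt (L : ℝ → Eucl 1) (L 1) s := by
      simpa using (L : ℝ →L[ℝ] Eucl 1).hasDerivAt (x := s)
    have h2 := ((hφ.differentiable (by simp) (L s)).hasFDerivAt.comp_hasDerivAt s h1).deriv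
    rw [h2, ← ofReal_norm, ← ofReal_norm]
    refine ENNReal.ofReal_le_ofReal ?_
    simpa using (fderiv ℝ φ (L s)).le_opNorm (L 1)
  calc ‖φ x‖ₑ = ‖(φ ∘ L) (L.symm x)‖ₑ := by simp
    _ ≤ ∫⁻ y in Set.Iic (L.symm x), ‖deriv (φ ∘ L) y‖ₑ :=
      HasCompactSupport.enorm_le_lintegral_Ici_deriv hψ hψc _
    _ ≤ ∫⁻ y, ‖deriv (φ ∘ L) y‖ₑ := setLIntegral_le_lintegral _ _
    _ ≤ ∫⁻ y, ‖fderiv ℝ φ (L y)‖ₑ := lintegral_mono hd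
    _ = ∫⁻ y, ‖fderiv ℝ φ y‖ₑ :=
      L.measurePreserving.lintegral_comp_emb L.toHomeomorph.measurableEmbedding
        fun y => ‖fderiv ℝ φ y‖ₑ
    _ = _ := by rw [eLpNorm_one_eq_lintegral_enorm]

lemma exists_eLpNorm_four_le_one {Ω : Set (Eucl 1)} (hΩ : Bornology.IsBounded Ω) :
    ∃ C : ℝ≥0, ∀ φ : Eucl 1 → ℝ, IsTestFunction Ω φ →
      eLpNorm φ 4 (volume.restrict Ω) ≤ C * eLpNorm (∇ φ) 2 (volume.restrict Ω) := by
  obtain ⟨C, hC⟩ := exists_eLpNorm_gradient_le (p := 1) hΩ (by norm_num) le_rfl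
  have hvol : volume Ω ^ (4 : ℝ)⁻¹ ≠ ⊤ :=
    ENNReal.rpow_ne_top_of_nonneg (by norm_num) hΩ.measure_lt_top.ne
  refine ⟨(volume Ω ^ (4 : ℝ)⁻¹).toNNReal * C, fun φ hφ => ?_⟩
  have h1 : ∀ᵐ x ∂(volume.restrict Ω), ‖φ x‖ₑ ≤ eLpNorm (∇ φ) 1 (volume.restrict Ω) := by
    refine ae_of_all _ fun x => ?_
    rw [← eLpNorm_fderiv_eq_restrict_gradient hφ]
    exact enorm_le_eLpNorm_fderiv_one (hφ.contDiff.of_le (by simp)) hφ.hasCompactSupport x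
  have h2 := eLpNorm_le_of_ae_enorm_bound (p := 4) h1
  refine h2.trans ?_
  rw [ENNReal.coe_mul, mul_assoc, ENNReal.coe_toNNReal hvol, Measure.restrict_apply_univ,
    smul_eq_mul, mul_comm (eLpNorm _ _ _)]
  simp only [ENNReal.toReal_ofNat]
  gcongr
  exact hC φ hφ

/-- **Sobolev inequality** for test functions in dimension at most four. -/
lemma exists_eLpNorm_four_le (hN1 : 1 ≤ N) (hN4 : N ≤ 4) (hΩ : Bornology.IsBounded Ω) :
    ∃ C : ℝ≥0, ∀ φ : Eucl N → ℝ, IsTestFunction Ω φ →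
      eLpNorm φ 4 (volume.restrict Ω) ≤ C * eLpNorm (∇ φ) 2 (volume.restrict Ω) := by
  obtain rfl | rfl | h3 : N = 1 ∨ N = 2 ∨ 3 ≤ N := by omega
  · exact exists_eLpNorm_four_le_one hΩ
  -- In dimension 2 the exponent `p = 2` is not below `N`; `p = 4/3` has Sobolev conjugate exactly
  -- 4.
  · refine exists_eLpNorm_four_le_of_lt (p := 4 / 3) hΩ ?_ ?_ ?_ ?_
    · rw [← NNReal.coe_le_coe]; push_cast; norm_num
    · rw [← NNReal.coe_le_coe]; push_cast; norm_num
    · rw [← NNReal.coe_lt_coe]; push_cast; norm_num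
    · push_cast; norm_num
  · refine exists_eLpNorm_four_le_of_lt (p := 2) hΩ one_le_two le_rfl ?_ ?_
    · exact_mod_cast h3
    · have : (4 : ℝ)⁻¹ ≤ (N : ℝ)⁻¹ := by
        gcongr
        exact_mod_cast hN4
      push_cast
      linarith

lemma eLpNorm_snd_two_le (w : L2Pair Ω) :
    eLpNorm w.snd 2 (volume.restrict Ω) ≤ ‖w‖ₑ := by
  rw [← Lp.enorm_def, ← ofReal_norm, ← ofReal_norm]
  exact ENNReal.ofReal_le_ofReal (WithLp.norm_snd_le _ w)

/-- The Sobolev inequality in `H_0^1(Ω)`, by density of the test functions. -/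
lemma eLpNorm_fst_four_le {C : ℝ≥0} (hC : ∀ φ : Eucl N → ℝ, IsTestFunction Ω φ →
      eLpNorm φ 4 (volume.restrict Ω) ≤ C * eLpNorm (∇ φ) 2 (volume.restrict Ω)) (u : H01 Ω) :
    eLpNorm (fn u) 4 (volume.restrict Ω) ≤ C * ‖u‖ₑ := by
  obtain ⟨w, hw, hwu⟩ := mem_closure_iff_seq_limit.1 u.2
  have hfst : Tendsto (fun n => (w n).fst) atTop (𝓝 (fn u)) :=
    ((WithLp.prod_continuous_ofLp 2 _ _).fst.tendsto _).comp hwu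
  obtain ⟨ns, hns, hae⟩ := (tendstoInMeasure_of_tendsto_Lp hfst).exists_seq_tendsto_ae
  have hbound : ∀ n, eLpNorm (w n).fst 4 (volume.restrict Ω) ≤ C * ‖w n‖ₑ := by
    intro n
    obtain ⟨φ, hφ, h1, h2⟩ := hw n
    rw [eLpNorm_congr_ae h1]
    refine (hC φ hφ).trans ?_
    rw [← eLpNorm_congr_ae h2]
    gcongr
    exact eLpNorm_snd_two_le (w n)
  -- Fatou along an a.e. convergent subsequence: the `L⁴` bound passes to the limit although
  -- convergence is only known in `L²`.
  refine (Lp.eLpNorm_lim_le_liminf_eLpNorm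
    (fun n => Lp.aestronglyMeasurable ((w (ns n)).fst)) _ hae).trans ?_
  have hlim : Tendsto (fun n => (C : ℝ≥0∞) * ‖w (ns n)‖ₑ) atTop (𝓝 (C * ‖u‖ₑ)) :=
    ENNReal.Tendsto.const_mul
      ((continuous_enorm.tendsto _).comp (hwu.comp hns.tendsto_atTop)) (Or.inr (by simp))
  exact (liminf_le_liminf (Eventually.of_forall fun n => hbound (ns n))).trans_eq hlim.liminf_eq

/-- The Sobolev embedding `H_0^1(Ω) → L⁴(Ω)`. -/
lemma exists_sobolevEmbedding (hN1 : 1 ≤ N) (hN4 : N ≤ 4) (hΩ : Bornology.IsBounded Ω) :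
    ∃ T : H01 Ω →L[ℝ] Lp ℝ 4 (volume.restrict Ω), ∀ u, T u =ᵐ[volume.restrict Ω] fn u := by
  obtain ⟨C, hC⟩ := exists_eLpNorm_four_le hN1 hN4 hΩ
  have hb := eLpNorm_fst_four_le hC
  have hmem : ∀ u : H01 Ω, MemLp (fn u) 4 (volume.restrict Ω) := fun u =>
    ⟨Lp.aestronglyMeasurable _, (hb u).trans_lt (ENNReal.mul_lt_top (by simp) (by simp))⟩
  let T₀ : H01 Ω →ₗ[ℝ] Lp ℝ 4 (volume.restrict Ω) :=
    { toFun := fun u => (hmem u).toLp _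
      map_add' := fun u v => by
        rw [← MemLp.toLp_add]
        exact MemLp.toLp_congr _ _ (Lp.coeFn_add (fn u) (fn v))
      map_smul' := fun c u => by
        rw [RingHom.id_apply, ← MemLp.toLp_const_smul]
        exact MemLp.toLp_congr _ _ (Lp.coeFn_smul c (fn u)) }
  refine ⟨T₀.mkContinuous C fun u => ?_, fun u => (hmem u).coeFn_toLp⟩
  have := ENNReal.toReal_mono (by finiteness) (hb u)
  simpa [T₀, Lp.norm_toLp] using this

end Sobolev

/-! ### Regularity, homogeneity and positivity of the two parts of the energy. -/

section Energy

open scoped ENNReal RealInnerProductSpace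

variable {N m : ℕ} {Ω : Set (Eucl N)}

lemma smul_quadForm {V X Y : Type*} [NormedAddCommGroup V] [NormedSpace ℝ V]
    [NormedAddCommGroup X] [NormedSpace ℝ X] [NormedAddCommGroup Y] [InnerProductSpace ℝ Y]
    (e : ℝ) (D : V →L[ℝ] X) (F : V →L[ℝ] Y) (A : Y →L[ℝ] Y) (t : ℝ) (v : V) :
    e * ‖D (t • v)‖ ^ 2 + ⟪A (F (t • v)), F (t • v)⟫ =
      t ^ 2 * (e * ‖D v‖ ^ 2 + ⟪A (F v), F v⟫) := by
  rw [map_smul, map_smul, map_smul, norm_smul, mul_pow, Real.norm_eq_abs, sq_abs,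
    real_inner_smul_left, real_inner_smul_right]
  ring

lemma contDiff_sum_sum_mul {H V : Type*} [NormedAddCommGroup H] [NormedSpace ℝ H]
    [NormedAddCommGroup V] [NormedSpace ℝ V] {S : V → V → ℝ}
    (hS : ContDiff ℝ 2 fun p : V × V => S p.1 p.2) (P : Fin m → H →L[ℝ] V)
    (g : Matrix (Fin m) (Fin m) ℝ) :
    ContDiff ℝ 2 fun u => ∑ i, ∑ j, g i j * S (P i u) (P j u) :=
  ContDiff.sum fun i _ => ContDiff.sum fun j _ =>
    contDiff_const.mul (hS.comp ((P i).contDiff.prodMk (P j).contDiff))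

noncomputable local instance normedSpaceHSpace : NormedSpace ℝ (HSpace Ω m) :=
  PiLp.normedSpace 2 ℝ (fun _ : Fin m => H01 Ω)

/-- `u ↦ u` as a continuous linear map `H_0^1(Ω) → L²(Ω)`. -/
noncomputable def fnL (Ω : Set (Eucl N)) : H01 Ω →L[ℝ] Lp ℝ 2 (volume.restrict Ω) :=
  WithLp.fstL 2 ℝ _ _ ∘L (H01 Ω).subtypeL

/-- The weak gradient as a continuous linear map `H_0^1(Ω) → L²(Ω, ℝ^N)`. -/
noncomputable def gradL (Ω : Set (Eucl N)) : H01 Ω →L[ℝ] Lp (Eucl N) 2 (volume.restrict Ω) :=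
  WithLp.sndL 2 ℝ _ _ ∘L (H01 Ω).subtypeL

@[simp] lemma fnL_apply (u : H01 Ω) : fnL Ω u = fn u := rfl

@[simp] lemma gradL_apply (u : H01 Ω) : gradL Ω u = grad u := rfl

lemma H01_ext_zero {u : H01 Ω} (h1 : fn u = 0) (h2 : grad u = 0) : u = 0 := by
  apply Subtype.ext
  apply WithLp.ofLp_injective 2
  exact Prod.ext h1 h2

/-- The quadratic part `∫_Ω ∑ᵢ (εᵢ |∇uᵢ|² + aᵢ uᵢ²)` of twice the energy. -/
noncomputable def quadPart (Ω : Set (Eucl N)) (ε : Fin m → ℝ) (a : Fin m → Eucl N → ℝ)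
    (u : HSpace Ω m) : ℝ :=
  ∫ x in Ω, ∑ i, (ε i * ‖grad (u i) x‖ ^ 2 + a i x * (fn (u i) x) ^ 2)

/-- The quartic part `∫_Ω ∑ᵢⱼ gᵢⱼ uᵢ² uⱼ²` of the energy. -/
noncomputable def quartPart (Ω : Set (Eucl N)) (g : Matrix (Fin m) (Fin m) ℝ)
    (u : HSpace Ω m) : ℝ :=
  ∫ x in Ω, ∑ i, ∑ j, g i j * (fn (u i) x) ^ 2 * (fn (u j) x) ^ 2

lemma energy_eq (ε : Fin m → ℝ) (a : Fin m → Eucl N → ℝ) (g : Matrix (Fin m) (Fin m) ℝ)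
    (u : HSpace Ω m) :
    energy Ω ε a g u = (1 / 2) * quadPart Ω ε a u - (1 / 4) * quartPart Ω g u := rfl

instance holderTriple_four_four_two : ENNReal.HolderTriple 4 4 2 where
  inv_add_inv_eq_inv := by
    have h4 : (4 : ℝ≥0∞) = 2 * 2 := by norm_num
    rw [h4, ENNReal.mul_inv (by simp) (by simp), ← mul_add, ENNReal.inv_two_add_inv_two, mul_one]

/-- Multiplication by an `L^∞` function on `L²`. -/
noncomputable def mulL {α : Type*} [MeasurableSpace α] {μ : Measure α} {b : α → ℝ}
    (hb : MemLp b ⊤ μ) : Lp ℝ 2 μ →L[ℝ] Lp ℝ 2 μ :=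
  (ContinuousLinearMap.mul ℝ ℝ).holderL μ ⊤ 2 2 (hb.toLp b)

lemma coeFn_mulL {α : Type*} [MeasurableSpace α] {μ : Measure α} {b : α → ℝ}
    (hb : MemLp b ⊤ μ) (f : Lp ℝ 2 μ) : mulL hb f =ᵐ[μ] fun x => b x * f x := by
  have h := (ContinuousLinearMap.mul ℝ ℝ).coeFn_holder (r := 2) (hb.toLp b) f
  filter_upwards [h, hb.coeFn_toLp] with x h1 h2
  refine h1.trans ?_
  simp [h2]

/-- The pointwise product `L⁴ × L⁴ → L²`. -/
noncomputable def mulFour {α : Type*} [MeasurableSpace α] (μ : Measure α) :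
    Lp ℝ 4 μ →L[ℝ] Lp ℝ 4 μ →L[ℝ] Lp ℝ 2 μ :=
  (ContinuousLinearMap.mul ℝ ℝ).holderL μ 4 4 2

lemma coeFn_mulFour {α : Type*} [MeasurableSpace α] {μ : Measure α} (f h : Lp ℝ 4 μ) :
    mulFour μ f h =ᵐ[μ] fun x => f x * h x :=
  (ContinuousLinearMap.mul ℝ ℝ).coeFn_holder f h

/-- Bounded forms composed with continuous linear maps make smoothness and homogeneity immediate. -/
lemma quadPart_eq {ε : Fin m → ℝ} {a : Fin m → Eucl N → ℝ}
    (ha : ∀ i, MemLp (a i) ⊤ (volume.restrict Ω)) (u : HSpace Ω m) :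
    quadPart Ω ε a u =
      ∑ i, (ε i * ‖gradL Ω (u i)‖ ^ 2 + ⟪mulL (ha i) (fnL Ω (u i)), fnL Ω (u i)⟫) := by
  have e1 : ∀ i, (fun x => ⟪mulL (ha i) (fn (u i)) x, fn (u i) x⟫) =ᵐ[volume.restrict Ω]
      fun x => a i x * (fn (u i) x) ^ 2 := by
    intro i
    filter_upwards [coeFn_mulL (ha i) (fn (u i))] with x hx
    rw [hx, real_inner_eq_re_inner, RCLike.inner_apply]
    simp
    ring
  have i1 : ∀ i, Integrable (fun x => a i x * (fn (u i) x) ^ 2) (volume.restrict Ω) := fun i =>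
    (L2.integrable_inner (𝕜 := ℝ) _ _).congr (e1 i)
  have i2 : ∀ i, Integrable (fun x => ‖grad (u i) x‖ ^ 2) (volume.restrict Ω) := fun i => by
    simpa using L2.integrable_inner (𝕜 := ℝ) (grad (u i)) (grad (u i))
  have i3 : ∀ i ∈ Finset.univ, Integrable
      (fun x => ε i * ‖grad (u i) x‖ ^ 2 + a i x * (fn (u i) x) ^ 2) (volume.restrict Ω) :=
    fun i _ => ((i2 i).const_mul (ε i)).add (i1 i)
  rw [quadPart, integral_finsetSum _ i3]
  refine Finset.sum_congr rfl fun i _ => ?_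
  rw [integral_add ((i2 i).const_mul (ε i)) (i1 i), integral_const_mul]
  have e2 : ∫ x in Ω, ‖grad (u i) x‖ ^ 2 = ‖gradL Ω (u i)‖ ^ 2 := by
    rw [gradL_apply, ← real_inner_self_eq_norm_sq, L2.inner_def]
    simp
  rw [e2, fnL_apply, L2.inner_def, integral_congr_ae (e1 i)]

/-! ### The quartic part, as inner products in `L²` of products of `L⁴` functions. -/

variable {T : H01 Ω →L[ℝ] Lp ℝ 4 (volume.restrict Ω)}

/-- The form `(v, w) ↦ ∫_Ω v² w²`, written through an embedding `T` into `L⁴`. -/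
noncomputable def sqForm (T : H01 Ω →L[ℝ] Lp ℝ 4 (volume.restrict Ω)) (v w : H01 Ω) : ℝ :=
  ⟪mulFour _ (T v) (T v), mulFour _ (T w) (T w)⟫

lemma inner_mulFour_ae (hT : ∀ u, T u =ᵐ[volume.restrict Ω] fn u) (v w : H01 Ω) :
    (fun x => ⟪mulFour _ (T v) (T v) x, mulFour _ (T w) (T w) x⟫) =ᵐ[volume.restrict Ω]
      fun x => (fn v x) ^ 2 * (fn w x) ^ 2 := by
  filter_upwards [coeFn_mulFour (T v) (T v), coeFn_mulFour (T w) (T w), hT v, hT w]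
    with x h1 h2 h3 h4
  rw [h1, h2, h3, h4, real_inner_eq_re_inner, RCLike.inner_apply]
  simp
  ring

lemma integrable_sq_mul_sq (hT : ∀ u, T u =ᵐ[volume.restrict Ω] fn u) (c : ℝ) (v w : H01 Ω) :
    Integrable (fun x => c * (fn v x) ^ 2 * (fn w x) ^ 2) (volume.restrict Ω) := by
  have h : Integrable (fun x => (fn v x) ^ 2 * (fn w x) ^ 2) (volume.restrict Ω) :=
    (L2.integrable_inner (𝕜 := ℝ) _ _).congr (inner_mulFour_ae hT v w)
  simpa only [mul_assoc] using h.const_mul c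

lemma integral_sq_mul_sq (hT : ∀ u, T u =ᵐ[volume.restrict Ω] fn u) (c : ℝ) (v w : H01 Ω) :
    ∫ x in Ω, c * (fn v x) ^ 2 * (fn w x) ^ 2 = c * sqForm T v w := by
  simp only [mul_assoc]
  rw [integral_const_mul, sqForm, L2.inner_def, integral_congr_ae (inner_mulFour_ae hT v w)]

lemma sqForm_smul (T : H01 Ω →L[ℝ] Lp ℝ 4 (volume.restrict Ω)) (t : ℝ) (v w : H01 Ω) :
    sqForm T (t • v) (t • w) = t ^ 4 * sqForm T v w := by
  simp only [sqForm, map_smul, smul_apply, real_inner_smul_left, real_inner_smul_right]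
  ring

lemma contDiff_sqForm (T : H01 Ω →L[ℝ] Lp ℝ 4 (volume.restrict Ω)) :
    ContDiff ℝ 2 fun p : H01 Ω × H01 Ω => sqForm T p.1 p.2 := by
  have h2 : ContDiff ℝ 2 fun v : H01 Ω => mulFour _ (T v) (T v) :=
    ((mulFour _).contDiff.comp T.contDiff).clm_apply T.contDiff
  exact (h2.comp contDiff_fst).inner ℝ (h2.comp contDiff_snd)

lemma quartPart_eq (hT : ∀ u, T u =ᵐ[volume.restrict Ω] fn u) (g : Matrix (Fin m) (Fin m) ℝ)
    (u : HSpace Ω m) : quartPart Ω g u = ∑ i, ∑ j, g i j * sqForm T (u i) (u j) := by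
  have hi := fun i j => integrable_sq_mul_sq hT (g i j) (u i) (u j)
  rw [quartPart, integral_finsetSum _ fun i _ => integrable_finsetSum _ fun j _ => hi i j]
  refine Finset.sum_congr rfl fun i _ => ?_
  rw [integral_finsetSum _ fun j _ => hi i j]
  exact Finset.sum_congr rfl fun j _ => integral_sq_mul_sq hT _ _ _

/-- The `i`-th component as a continuous linear map. -/
noncomputable def compL (Ω : Set (Eucl N)) (i : Fin m) : HSpace Ω m →L[ℝ] H01 Ω :=
  PiLp.proj 2 (fun _ : Fin m => H01 Ω) i

lemma contDiff_quadPart (ε : Fin m → ℝ) {a : Fin m → Eucl N → ℝ}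
    (ha : ∀ i, MemLp (a i) ⊤ (volume.restrict Ω)) : ContDiff ℝ 2 (quadPart Ω ε a) := by
  rw [funext (quadPart_eq ha)]
  refine ContDiff.sum fun i _ => ?_
  have h1 : ContDiff ℝ 2 fun u : HSpace Ω m => gradL Ω (u i) :=
    (gradL Ω ∘L compL Ω i).contDiff
  have h2 : ContDiff ℝ 2 fun u : HSpace Ω m => fnL Ω (u i) := (fnL Ω ∘L compL Ω i).contDiff
  exact (contDiff_const.mul (h1.norm_sq ℝ)).add
    (((mulL (ha i)).contDiff.comp h2).inner ℝ h2)

lemma contDiff_quartPart (hT : ∀ u, T u =ᵐ[volume.restrict Ω] fn u)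
    (g : Matrix (Fin m) (Fin m) ℝ) : ContDiff ℝ 2 (quartPart Ω g) := by
  have h : quartPart Ω g = fun u => ∑ i, ∑ j, g i j * sqForm T (compL Ω i u) (compL Ω j u) :=
    funext (quartPart_eq hT g)
  rw [h]
  exact contDiff_sum_sum_mul (contDiff_sqForm T) (compL Ω) g

lemma quadPart_smul (ε : Fin m → ℝ) {a : Fin m → Eucl N → ℝ}
    (ha : ∀ i, MemLp (a i) ⊤ (volume.restrict Ω)) (t : ℝ) (u : HSpace Ω m) :
    quadPart Ω ε a (t • u) = t ^ 2 * quadPart Ω ε a u := by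
  rw [quadPart_eq ha, quadPart_eq ha, Finset.mul_sum]
  exact Finset.sum_congr rfl fun i _ => smul_quadForm (ε i) (gradL Ω) (fnL Ω) (mulL (ha i)) t (u i)

lemma quartPart_smul (hT : ∀ u, T u =ᵐ[volume.restrict Ω] fn u) (g : Matrix (Fin m) (Fin m) ℝ)
    (t : ℝ) (u : HSpace Ω m) : quartPart Ω g (t • u) = t ^ 4 * quartPart Ω g u := by
  rw [quartPart_eq hT, quartPart_eq hT, Finset.mul_sum]
  refine Finset.sum_congr rfl fun i _ => ?_
  rw [Finset.mul_sum]
  refine Finset.sum_congr rfl fun j _ => ?_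
  have h : sqForm T ((t • u) i) ((t • u) j) = t ^ 4 * sqForm T (u i) (u j) :=
    sqForm_smul T t (u i) (u j)
  rw [h]
  ring

/-- Either hypothesis on `g` makes the form strictly positive on the nonnegative cone, which is
where `yᵢ = uᵢ(x)²` lies. For positive entries the diagonal terms suffice to force `y = 0`. -/
lemma sum_mul_mul_nonneg {g : Matrix (Fin m) (Fin m) ℝ} (hg : (∀ i j, 0 < g i j) ∨ g.PosDef)
    {y : Fin m → ℝ} (hy : ∀ i, 0 ≤ y i) :
    0 ≤ ∑ i, ∑ j, g i j * y i * y j ∧ (∑ i, ∑ j, g i j * y i * y j = 0 → ∀ i, y i = 0) := by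
  rcases hg with hg | hg
  · have hnn : ∀ i j, 0 ≤ g i j * y i * y j := fun i j =>
      mul_nonneg (mul_nonneg (hg i j).le (hy i)) (hy j)
    refine ⟨Finset.sum_nonneg fun i _ => Finset.sum_nonneg fun j _ => hnn i j, fun h i => ?_⟩
    have h1 := (Finset.sum_eq_zero_iff_of_nonneg
      fun i _ => Finset.sum_nonneg fun j _ => hnn i j).1 h i (Finset.mem_univ i)
    have h2 := (Finset.sum_eq_zero_iff_of_nonneg fun j _ => hnn i j).1 h1 i (Finset.mem_univ i)
    simpa [(hg i i).ne'] using h2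
  · have hs : ∑ i, ∑ j, g i j * y i * y j = star y ⬝ᵥ g.mulVec y := by
      simp only [dotProduct, Matrix.mulVec, Finset.mul_sum]
      refine Finset.sum_congr rfl fun i _ => Finset.sum_congr rfl fun j _ => ?_
      simp
      ring
    rw [hs]
    refine ⟨hg.posSemidef.dotProduct_mulVec_nonneg y, fun h i => ?_⟩
    by_contra hi
    exact absurd h (hg.dotProduct_mulVec_pos (x := y) fun h0 => hi (by simp [h0])).ne'

/-- If `G(u) = 0`, every `uᵢ` vanishes a.e., so the `aᵢ` terms drop out and `Q(u) = 0` leaves `∑ εᵢ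
‖∇uᵢ‖² = 0`. Both entries of each pair `(uᵢ, ∇uᵢ)` are then zero. -/
lemma quartPart_pos (hT : ∀ u, T u =ᵐ[volume.restrict Ω] fn u) {ε : Fin m → ℝ}
    (hε : ∀ i, 0 < ε i) {a : Fin m → Eucl N → ℝ}
    (ha : ∀ i, MemLp (a i) ⊤ (volume.restrict Ω)) {g : Matrix (Fin m) (Fin m) ℝ}
    (hg : (∀ i j, 0 < g i j) ∨ g.PosDef) {u : HSpace Ω m} (hu : u ≠ 0)
    (hQ : quadPart Ω ε a u = quartPart Ω g u) : 0 < quartPart Ω g u := by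
  have hpt := fun x => sum_mul_mul_nonneg hg (y := fun i => (fn (u i) x) ^ 2)
    fun i => sq_nonneg _
  have hint : Integrable (fun x => ∑ i, ∑ j, g i j * (fn (u i) x) ^ 2 * (fn (u j) x) ^ 2)
      (volume.restrict Ω) :=
    integrable_finsetSum _ fun i _ => integrable_finsetSum _ fun j _ =>
      integrable_sq_mul_sq hT (g i j) (u i) (u j)
  have h0 : 0 ≤ quartPart Ω g u := integral_nonneg fun x => (hpt x).1
  refine h0.lt_of_ne fun h => hu ?_
  have hae := (integral_eq_zero_iff_of_nonneg (fun x => (hpt x).1) hint).1 h.symm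
  have hfn : ∀ i, fn (u i) = 0 := by
    intro i
    rw [Lp.eq_zero_iff_ae_eq_zero]
    filter_upwards [hae] with x hx
    simpa using (hpt x).2 hx i
  rw [← h, quadPart_eq ha] at hQ
  simp only [fnL_apply, hfn, inner_zero_right, add_zero, gradL_apply] at hQ
  rw [Finset.sum_eq_zero_iff_of_nonneg
    fun i _ => mul_nonneg (hε i).le (sq_nonneg _)] at hQ
  ext i : 1
  refine H01_ext_zero (hfn i) ?_
  have := hQ i (Finset.mem_univ i)
  simpa [(hε i).ne'] using this

end Energy

/-- For a `C²` function of the form `t² Q(u) / 2 - t⁴ G(u) / 4` along rays, the first two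
derivatives at `u` in the radial direction. -/
lemma fderiv_and_hessian_self {H : Type*} [NormedAddCommGroup H] [NormedSpace ℝ H] {E : H → ℝ}
    (hE : ContDiff ℝ 2 E) {u : H} {q r : ℝ}
    (h : ∀ t : ℝ, E (t • u) = (1 / 2) * (t ^ 2 * q) - (1 / 4) * (t ^ 4 * r)) :
    fderiv ℝ E u u = q - r ∧ hessian E u u u = q - 3 * r := by
  have hray : ∀ t : ℝ, HasDerivAt (fun t : ℝ => t • u) u t := fun t => by
    simpa using (hasDerivAt_id t).smul_const u
  have h1 : ∀ t : ℝ, fderiv ℝ E (t • u) u = t * q - t ^ 3 * r := by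
    intro t
    have e1 : HasDerivAt (fun t : ℝ => E (t • u)) (fderiv ℝ E (t • u) u) t :=
      ((hE.differentiable (by simp) (t • u)).hasFDerivAt).comp_hasDerivAt t (hray t)
    rw [funext h] at e1
    have e2 : HasDerivAt (fun t : ℝ => (1 / 2) * (t ^ 2 * q) - (1 / 4) * (t ^ 4 * r))
        ((1 / 2) * (2 * t * q) - (1 / 4) * (4 * t ^ 3 * r)) t := by
      have p2 : HasDerivAt (fun t : ℝ => t ^ 2) (2 * t) t := by simpa using hasDerivAt_pow 2 t
      have p4 : HasDerivAt (fun t : ℝ => t ^ 4) (4 * t ^ 3) t := by simpa using hasDerivAt_pow 4 t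
      exact ((p2.mul_const q).const_mul _).sub ((p4.mul_const r).const_mul _)
    rw [e1.unique e2]
    ring
  refine ⟨by simpa using h1 1, ?_⟩
  have e1 : HasDerivAt (fun t : ℝ => fderiv ℝ E (t • u) u) (hessian E u u u) 1 := by
    have e := (hasFDerivAt_fderiv hE ((1 : ℝ) • u)).comp_hasDerivAt (1 : ℝ) (hray 1)
    simpa using! e.clm_apply (hasDerivAt_const (1 : ℝ) u)
  rw [funext h1] at e1
  have e2 : HasDerivAt (fun t : ℝ => t * q - t ^ 3 * r) (1 * q - 3 * 1 ^ 2 * r) 1 := by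
    have p3 : HasDerivAt (fun t : ℝ => t ^ 3) (3 * 1 ^ 2) 1 := by simpa using hasDerivAt_pow 3 (1 : ℝ)
    exact ((hasDerivAt_id (1 : ℝ)).mul_const q).sub (p3.mul_const r)
  rw [e1.unique e2]
  ring

end Nehari

theorem proposition2p3 {N m : ℕ} (hN1 : 1 ≤ N) (hN4 : N ≤ 4)
    (Ω : Set (EuclideanSpace ℝ (Fin N)))
    (hΩopen : IsOpen Ω) (hΩconn : IsConnected Ω) (hΩbdd : Bornology.IsBounded Ω)
    (ε : Fin m → ℝ) (hε : ∀ i, 0 < ε i)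
    (g : Matrix (Fin m) (Fin m) ℝ) (hgsymm : g.IsSymm)
    (hg : (∀ i j, 0 < g i j) ∨ g.PosDef)
    (a : Fin m → EuclideanSpace ℝ (Fin N) → ℝ)
    (ha : ∀ i, MemLp (a i) ⊤ (volume.restrict Ω))
    (ha1 : ∀ i, ∀ᵐ x ∂(volume.restrict Ω), -Nehari.firstDirichletEigenvalue Ω < a i x) :
    ContDiff ℝ 2 (Nehari.energy Ω ε a g) ∧
    (∀ u : Nehari.HSpace Ω m,
      Nehari.IsLocalMinimizerOn (Nehari.energy Ω ε a g)
        (Nehari.nehari (Nehari.energy Ω ε a g)) u →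
      Nehari.IsOneSaddle (Nehari.energy Ω ε a g) u) ∧
    (∀ u : Nehari.HSpace Ω m, u ≠ 0 →
      Nehari.IsOneSaddle (Nehari.energy Ω ε a g) u →
      Nehari.IsNondegenerate (Nehari.energy Ω ε a g) u →
      Nehari.IsStrictLocalMinimizerOn (Nehari.energy Ω ε a g)
        (Nehari.nehari (Nehari.energy Ω ε a g)) u) := by
  obtain ⟨T, hT⟩ := Nehari.exists_sobolevEmbedding hN1 hN4 hΩbdd
  have hE : ContDiff ℝ 2 (Nehari.energy Ω ε a g) :=
    (contDiff_const.mul (Nehari.contDiff_quadPart ε ha)).sub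
      (contDiff_const.mul (Nehari.contDiff_quartPart hT g))
  have hneg : ∀ u ∈ Nehari.nehari (Nehari.energy Ω ε a g),
      Nehari.hessian (Nehari.energy Ω ε a g) u u u < 0 := by
    rintro u ⟨hu0, hu⟩
    obtain ⟨h1, h2⟩ := Nehari.fderiv_and_hessian_self hE (u := u) fun t => by
      rw [Nehari.energy_eq, Nehari.quadPart_smul ε ha, Nehari.quartPart_smul hT]
    -- On the manifold `Q = G`, so the radial second derivative `Q - 3G` equals `-2G`.
    have hQ := sub_eq_zero.1 (h1.symm.trans hu)
    have hpos := Nehari.quartPart_pos hT hε ha hg hu0 hQ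
    rw [h2, hQ]
    linarith
  exact ⟨hE, fun u => Nehari.isOneSaddle_of_isLocalMinimizerOn_nehari hE hneg,
    fun u => Nehari.isStrictLocalMinimizerOn_nehari hE hneg⟩
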